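/- Theorem (Positivity of the discrete inf-sup constant). Let $I=(a,b)$ be a bounded interval, $p\ge 2$ and $L\ge 1$ integers, and write $(\cdot,\cdot)_{0,I}$, $\|\cdot\|_{0,I}$ for the inner product and norm of $L^2(I)$. For a mesh $\mathcal T$ of $[a,b]$ and a degree $r\ge 0$ let $\mathcal S^{r}(\mathcal T)$ be the span of the B-splines of degree $r$ for the open knot vector of $\mathcal T$ (the end points $a$, $b$ repeated $r+1$ times, each interior breakpoint taken once). Let $h>0$, let $\mathcal T_h=\mathcal M_h^{(0)}$ be a uniform mesh of $[a,b]$ with mesh size $h$, and let $\mathcal M_h^{(1)},\dots,\mathcal M_h^{(L)}$ be obtained from it by dyadic coarsening: $\mathcal M_h^{(k)}$ arises from $\mathcal M_h^{(k-1)}$ by removing every second interior breakpoint, so that each element of $\mathcal M_h^{(k)}$ is the union of exactly two adjacent elements of $\mathcal M_h^{(k-1)}$. Put \[ V_h=\mathcal S^p(\mathcal T_h)\cap H_0^1(I),\qquad Q_L=\mathcal S^{p-1}(\mathcal M_h^{(L)}). \] Then for each $h>0$ there exists $\alpha_{\mathrm{MQ}}(h)>0$ (which may also depend on $a,b,p,L$)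 such that \[ \inf_{q_h\in Q_L\setminus\{0\}}\ \sup_{v_h\in V_h\setminus\{0\}}\ \frac{(v_h,q_h)_{0,I}}{\|v_h\|_{0,I}\,\|q_h\|_{0,I}}\ \ge\ \alpha_{\mathrm{MQ}}(h). \] -/

import Mathlib

open MeasureTheory
open scoped ContDiff

namespace SplineInfSup

/-- The real Hilbert space `L²(I)` over the open interval `I = (a, b)`. -/
abbrev L2 (a b : ℝ) : Type := Lp ℝ 2 (volume.restrict (Set.Ioo a b))

/-- A mesh of the interval `[a, b]`: breakpoints `a = x 0 < x 1 < ⋯ < x n = b`, hence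
`n` elements `[x i, x (i+1)]`. -/
structure Mesh (a b : ℝ) where
  n : ℕ
  x : Fin (n + 1) → ℝ
  strictMono : StrictMono x
  left : x 0 = a
  right : x (Fin.last n) = b

/-- All elements of the mesh have length `h`. -/
def Mesh.IsUniform {a b : ℝ} (T : Mesh a b) (h : ℝ) : Prop :=
  ∀ i : Fin T.n, T.x i.succ - T.x i.castSucc = h

/-- `T'` arises from `T` by removing every second interior breakpoint (those of odd index):
`T` has twice as many elements as `T'`, and each element of `T'` is the union of two adjacent
elements of `T`. -/
def Mesh.IsDyadicCoarsening {a b : ℝ} (T T' : Mesh a b) : Prop :=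
  ∃ hn : T.n = 2 * T'.n, ∀ i : Fin (T'.n + 1), T'.x i = T.x ⟨2 * (i : ℕ), by omega⟩

/-- A dyadic hierarchy: each level is the dyadic coarsening of the previous one. -/
def IsDyadicHierarchy {a b : ℝ} {L : ℕ} (M : Fin (L + 1) → Mesh a b) : Prop :=
  ∀ k : Fin L, (M k.castSucc).IsDyadicCoarsening (M k.succ)

/-- The open knot vector of degree `p` of a mesh: the end points `a`, `b` are repeated `p + 1`
times and each interior breakpoint occurs once.  The knots are `t 0, …, t (n + 2 p)`;
beyond that index the sequence is continued by the constant `b`, and these values are not used. -/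
def Mesh.openKnots {a b : ℝ} (T : Mesh a b) (p j : ℕ) : ℝ :=
  T.x ⟨min (j - p) T.n, by omega⟩

/-- The B-spline `N_i^p` of degree `p` for the knot sequence `t` (Cox–de Boor recursion; a
fraction with zero denominator is zero). -/
noncomputable def bspline (t : ℕ → ℝ) : ℕ → ℕ → ℝ → ℝ
  | 0, i, x => if t i ≤ x ∧ x < t (i + 1) then 1 else 0
  | p + 1, i, x =>
      (x - t i) / (t (i + p + 1) - t i) * bspline t p i x +
        (t (i + p + 2) - x) / (t (i + p + 2) - t (i + 1)) * bspline t p (i + 1) x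

theorem measurable_bspline (t : ℕ → ℝ) (p i : ℕ) : Measurable (bspline t p i) := by
  induction p generalizing i with
  | zero =>
    have : bspline t 0 i = (Set.Ico (t i) (t (i + 1))).indicator (fun _ => (1 : ℝ)) := by
      funext x
      simp [bspline, Set.indicator, Set.mem_Ico]
    rw [this]
    exact measurable_const.indicator measurableSet_Ico
  | succ p ih =>
    have h1 := ih i
    have h2 := ih (i + 1)
    have : bspline t (p + 1) i = fun x =>
      (x - t i) / (t (i + p + 1) - t i) * bspline t p i x +
        (t (i + p + 2) - x) / (t (i + p + 2) - t (i + 1)) * bspline t p (i + 1) x := by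
      funext x; rfl
    rw [this]
    fun_prop

theorem bounded_bspline (t : ℕ → ℝ) (a b : ℝ) (p i : ℕ) :
    ∃ C : ℝ, ∀ x ∈ Set.Ioo a b, ‖bspline t p i x‖ ≤ C := by
  induction p generalizing i with
  | zero =>
    refine ⟨1, fun x _ => ?_⟩
    simp only [bspline]
    split_ifs <;> simp
  | succ p ih =>
    obtain ⟨C, hC⟩ := ih i
    obtain ⟨D, hD⟩ := ih (i + 1)
    have hb : ∀ f : ℝ → ℝ, Continuous f → ∃ K : ℝ, ∀ x ∈ Set.Ioo a b, ‖f x‖ ≤ K := by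
      intro f hf
      obtain ⟨K, hK⟩ := (isCompact_Icc (a := a) (b := b)).exists_bound_of_continuousOn
        hf.continuousOn
      exact ⟨K, fun x hx => hK x (Set.Ioo_subset_Icc_self hx)⟩
    obtain ⟨K, hK⟩ := hb (fun x => (x - t i) / (t (i + p + 1) - t i)) (by fun_prop)
    obtain ⟨K', hK'⟩ := hb
      (fun x => (t (i + p + 2) - x) / (t (i + p + 2) - t (i + 1))) (by fun_prop)
    refine ⟨K * C + K' * D, fun x hx => ?_⟩
    simp only [bspline]
    refine (norm_add_le _ _).trans (add_le_add ?_ ?_)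
    · rw [norm_mul]
      exact mul_le_mul (hK x hx) (hC x hx) (norm_nonneg _) ((norm_nonneg _).trans (hK x hx))
    · rw [norm_mul]
      exact mul_le_mul (hK' x hx) (hD x hx) (norm_nonneg _) ((norm_nonneg _).trans (hK' x hx))

theorem memLp_bspline (t : ℕ → ℝ) (a b : ℝ) (p i : ℕ) :
    MemLp (bspline t p i) 2 (volume.restrict (Set.Ioo a b)) := by
  obtain ⟨C, hC⟩ := bounded_bspline t a b p i
  exact MemLp.of_bound (measurable_bspline t p i).aestronglyMeasurable C
    (ae_restrict_of_forall_mem measurableSet_Ioo hC)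

/-- The spline space `S^p(T)` of degree `p` on a mesh `T` with `n` elements: the span of the
`n + p` B-splines of the open knot vector, viewed in `L²(a, b)`. -/
noncomputable def splineSpace {a b : ℝ} (p : ℕ) (T : Mesh a b) : Submodule ℝ (L2 a b) :=
  Submodule.span ℝ
    (Set.range fun i : Fin (T.n + p) => (memLp_bspline (T.openKnots p) a b p i).toLp)

/-- Test functions: `C_c^∞(a, b)`. -/
def IsTestFunction (a b : ℝ) (φ : ℝ → ℝ) : Prop :=
  ContDiff ℝ ∞ φ ∧ HasCompactSupport φ ∧ tsupport φ ⊆ Set.Ioo a b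

/-- `g ∈ L²(a, b)` is the weak derivative of `u ∈ L²(a, b)`. -/
def IsWeakDeriv {a b : ℝ} (u g : L2 a b) : Prop :=
  ∀ φ : ℝ → ℝ, IsTestFunction a b φ →
    ∫ x in Set.Ioo a b, u x * deriv φ x = -∫ x in Set.Ioo a b, g x * φ x

theorem integrable_mul_of_continuous {a b : ℝ} (u : L2 a b) {ψ : ℝ → ℝ} (hψ : Continuous ψ) :
    Integrable (fun x => u x * ψ x) (volume.restrict (Set.Ioo a b)) := by
  obtain ⟨C, hC⟩ := (isCompact_Icc (a := a) (b := b)).exists_bound_of_continuousOn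
    hψ.continuousOn
  have h1 : Integrable (fun x => u x) (volume.restrict (Set.Ioo a b)) :=
    (Lp.memLp u).integrable (by norm_num)
  exact h1.mul_bdd (c := C) hψ.aestronglyMeasurable
    (ae_restrict_of_forall_mem measurableSet_Ioo
      fun x hx => hC x (Set.Ioo_subset_Icc_self hx))

theorem IsTestFunction.continuous_deriv {a b : ℝ} {φ : ℝ → ℝ} (h : IsTestFunction a b φ) :
    Continuous (deriv φ) :=
  h.1.continuous_deriv (by simp)

theorem IsWeakDeriv.add {a b : ℝ} {u g v k : L2 a b} (h : IsWeakDeriv u g)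
    (h' : IsWeakDeriv v k) : IsWeakDeriv (u + v) (g + k) := by
  intro φ hφ
  have hc := hφ.1.continuous
  have hd := hφ.continuous_deriv
  have e1 : ∫ x in Set.Ioo a b, (u + v : L2 a b) x * deriv φ x =
      ∫ x in Set.Ioo a b, (u x * deriv φ x + v x * deriv φ x) := by
    refine integral_congr_ae ?_
    filter_upwards [Lp.coeFn_add u v] with x hx
    rw [hx, Pi.add_apply, add_mul]
  have e2 : ∫ x in Set.Ioo a b, (g + k : L2 a b) x * φ x =
      ∫ x in Set.Ioo a b, (g x * φ x + k x * φ x) := by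
    refine integral_congr_ae ?_
    filter_upwards [Lp.coeFn_add g k] with x hx
    rw [hx, Pi.add_apply, add_mul]
  rw [e1, e2, integral_add (integrable_mul_of_continuous u hd) (integrable_mul_of_continuous v hd),
    integral_add (integrable_mul_of_continuous g hc) (integrable_mul_of_continuous k hc),
    h φ hφ, h' φ hφ]
  ring

theorem IsWeakDeriv.smul {a b : ℝ} {u g : L2 a b} (c : ℝ) (h : IsWeakDeriv u g) :
    IsWeakDeriv (c • u) (c • g) := by
  intro φ hφ
  have e1 : ∫ x in Set.Ioo a b, (c • u : L2 a b) x * deriv φ x =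
      ∫ x in Set.Ioo a b, c * (u x * deriv φ x) := by
    refine integral_congr_ae ?_
    filter_upwards [Lp.coeFn_smul c u] with x hx
    rw [hx, Pi.smul_apply, smul_eq_mul, mul_assoc]
  have e2 : ∫ x in Set.Ioo a b, (c • g : L2 a b) x * φ x =
      ∫ x in Set.Ioo a b, c * (g x * φ x) := by
    refine integral_congr_ae ?_
    filter_upwards [Lp.coeFn_smul c g] with x hx
    rw [hx, Pi.smul_apply, smul_eq_mul, mul_assoc]
  rw [e1, e2, integral_const_mul, integral_const_mul, h φ hφ]
  ring

/-- `u` has a continuous representative on `[a, b]` that vanishes at both end points, that is,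
the boundary trace of `u` exists and is zero. -/
def HasZeroTrace {a b : ℝ} (u : L2 a b) : Prop :=
  ∃ w : ℝ → ℝ, ContinuousOn w (Set.Icc a b) ∧
    (u : ℝ → ℝ) =ᵐ[volume.restrict (Set.Ioo a b)] w ∧ w a = 0 ∧ w b = 0

/-- The Sobolev space `H_0^1(a, b)`: the functions in `L²(a, b)` with a weak derivative in
`L²(a, b)` and with zero boundary trace. -/
def H01 (a b : ℝ) : Submodule ℝ (L2 a b) where
  carrier := {u | (∃ g : L2 a b, IsWeakDeriv u g) ∧ HasZeroTrace u}
  add_mem' := by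
    rintro u v ⟨⟨g, hg⟩, w, hw, hu, ha, hb⟩ ⟨⟨k, hk⟩, w', hw', hv, ha', hb'⟩
    refine ⟨⟨g + k, hg.add hk⟩, w + w', hw.add hw', ?_, by simp [ha, ha'], by simp [hb, hb']⟩
    filter_upwards [Lp.coeFn_add u v, hu, hv] with x h1 h2 h3
    rw [h1, Pi.add_apply, Pi.add_apply, h2, h3]
  zero_mem' := by
    refine ⟨⟨0, fun φ _ => ?_⟩, 0, continuousOn_const, Lp.coeFn_zero _ _ _, rfl, rfl⟩
    have h0 := Lp.coeFn_zero ℝ 2 (volume.restrict (Set.Ioo a b))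
    have e : ∀ ψ : ℝ → ℝ, ∫ x in Set.Ioo a b, (0 : L2 a b) x * ψ x = 0 := by
      intro ψ
      refine integral_eq_zero_of_ae ?_
      filter_upwards [h0] with x hx
      rw [hx]; simp
    rw [e, e, neg_zero]
  smul_mem' := by
    rintro c u ⟨⟨g, hg⟩, w, hw, hu, ha, hb⟩
    refine ⟨⟨c • g, hg.smul c⟩, c • w, hw.const_smul c, ?_, by simp [ha], by simp [hb]⟩
    filter_upwards [Lp.coeFn_smul c u, hu] with x h1 h2
    rw [h1, Pi.smul_apply, Pi.smul_apply, h2]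

/-- The inf-sup constant of two subspaces of a real inner product space,
`inf_{q ∈ Q \ {0}} sup_{v ∈ V \ {0}} (v, q) / (‖v‖ ‖q‖)`. -/
noncomputable def infSupConst {E : Type*} [NormedAddCommGroup E] [InnerProductSpace ℝ E]
    (V Q : Submodule ℝ E) : ℝ :=
  ⨅ q : {q : E // q ∈ Q ∧ q ≠ 0}, ⨆ v : {v : E // v ∈ V ∧ v ≠ 0},
    inner ℝ (v : E) (q : E) / (‖(v : E)‖ * ‖(q : E)‖)

/-- The fine space `V_h = S^p(T) ∩ H_0^1(a, b)`. -/
noncomputable def fineSpace {a b : ℝ} (p : ℕ) (T : Mesh a b) : Submodule ℝ (L2 a b) :=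
  splineSpace p T ⊓ H01 a b

/-- The coarse space `Q_L = S^{p-1}(T)`, on the coarsest mesh `T`. -/
noncomputable def coarseSpace {a b : ℝ} (p : ℕ) (T : Mesh a b) : Submodule ℝ (L2 a b) :=
  splineSpace (p - 1) T

end SplineInfSup

/-! Both spaces are finite-dimensional, so the constant is positive as soon as no nonzero `q` in the
coarse space is orthogonal to the fine space. This is proved by counting sign alternations in two
ways, using only the interior B-splines of degree `p` as test functions.

Put `r = p - 1`, and let `Q` be the continuous representative of `q`. Integration by parts turns
orthogonality to the interior B-splines into equality of all normalized moments of an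
antiderivative. Shifting it by a constant gives `R` with `R' = Q`, orthogonal to all splines of
degree `r`. Integrating further lowers the degree by one each time, and every new antiderivative
vanishes at `a` and `b`. After degree 0 the result is a function `W` that vanishes at all fine
breakpoints.

Lower bound: if `W` is nonzero on `N > 0` fine elements, then `W'` has `N + 1` alternating signs.
Each differentiation of a function with zero end values gains one, so `R` has `N + r + 1`, and `Q =
R'` has at least `N + r` (`exists_altSeq_of_orthogonal`).

Upper bound: a spline of degree `r` whose top derivative is nonzero on `N'` coarse elements has at
most `N' + r` (`IsPiecewise.exists_finset`). Hence `N ≤ N'`. But `Q` vanishes on no subinterval of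
those coarse elements, each of which contains at least two fine ones, so `2 N' ≤ N`. This
contradicts `N > 0`; thus `W` and `Q` vanish (`eq_zero_of_orthogonal`). -/

namespace SplineInfSup

variable {a b : ℝ}

/-! ### Sign alternations and Rolle's theorem. -/

/-- `f` takes alternating signs at some `k` increasing points of `[a, c)`, and has the sign of `s`
at the last one. -/
def AltSeq (a : ℝ) (f : ℝ → ℝ) : ℕ → ℝ → ℝ → Prop
  | 0, _, _ => True
  | k + 1, s, c => ∃ x, a ≤ x ∧ x < c ∧ 0 < s * f x ∧ AltSeq a f k (-s) x

theorem AltSeq.mono {a : ℝ} {f : ℝ → ℝ} {k : ℕ} {s c c' : ℝ} (h : AltSeq a f k s c)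
    (hc : c ≤ c') : AltSeq a f k s c' := by
  cases k with
  | zero => trivial
  | succ k =>
    obtain ⟨x, h1, h2, h3⟩ := h
    exact ⟨x, h1, h2.trans_le hc, h3⟩

/-- Otherwise `s * f` would be nonincreasing. Right derivatives are used because the derivative of a
piecewise linear spline jumps at breakpoints; the factor `s` treats both signs at once. -/
theorem exists_right_deriv_pos {f f' : ℝ → ℝ} {x y s : ℝ} (hxy : x < y)
    (hf : ContinuousOn f (Set.Icc x y))
    (hd : ∀ z ∈ Set.Ico x y, HasDerivWithinAt f (f' z) (Set.Ioi z) z)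
    (h : s * f x < s * f y) : ∃ z ∈ Set.Ico x y, 0 < s * f' z := by
  by_contra! hn
  have := image_le_of_deriv_right_le_deriv_boundary (f := fun z => s * f z)
    (f' := fun z => s * f' z) (a := x) (b := y) (hf.const_mul s)
    (fun z hz => ((hd z hz).Ici_of_Ioi).const_mul s) (B := fun _ => s * f x) (B' := fun _ => 0)
    le_rfl continuousOn_const (fun z _ => hasDerivWithinAt_const _ _ _) hn
    (Set.right_mem_Icc.2 hxy.le)
  exact absurd this (not_le.2 h)

/-- Rolle's theorem for alternations, given how many alternations `f'` has before the first
sign of `f`. -/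
theorem AltSeq.right_deriv_aux {a b : ℝ} {f f' : ℝ → ℝ} (hf : ContinuousOn f (Set.Ico a b))
    (hd : ∀ z ∈ Set.Ico a b, HasDerivWithinAt f (f' z) (Set.Ioi z) z) {j : ℕ}
    (hj : ∀ s x, x ∈ Set.Ico a b → 0 < s * f x → AltSeq a f' j s x) {k : ℕ} {s x : ℝ}
    (hx : x ∈ Set.Ico a b) (hs : 0 < s * f x) (h : AltSeq a f k (-s) x) :
    AltSeq a f' (j + k) s x := by
  induction k generalizing s x with
  | zero => exact hj s x hx hs
  | succ k ih =>
    obtain ⟨y, hay, hyx, hy, h'⟩ := h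
    have h1 := ih ⟨hay, hyx.trans hx.2⟩ hy h'
    obtain ⟨z, hz, hz'⟩ := exists_right_deriv_pos (s := s) hyx
      (hf.mono fun u hu => ⟨hay.trans hu.1, hu.2.trans_lt hx.2⟩)
      (fun u hu => hd u ⟨hay.trans hu.1, hu.2.trans hx.2⟩) (by linarith)
    exact ⟨z, hay.trans hz.1, hz.2, hz', h1.mono hz.1⟩

/-- Between consecutive points of opposite sign the derivative takes the sign of the later value,
and `k + 1` points have `k` gaps. -/
theorem AltSeq.right_deriv {a b : ℝ} {f f' : ℝ → ℝ} (hf : ContinuousOn f (Set.Ico a b))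
    (hd : ∀ z ∈ Set.Ico a b, HasDerivWithinAt f (f' z) (Set.Ioi z) z) {k : ℕ} {s : ℝ}
    (h : AltSeq a f (k + 1) s b) : AltSeq a f' k s b := by
  obtain ⟨x, hax, hxb, hx, h'⟩ := h
  have := AltSeq.right_deriv_aux hf hd (j := 0) (fun _ _ _ _ => trivial) ⟨hax, hxb⟩ hx h'
  rw [zero_add] at this
  exact this.mono hxb.le

/-- If `f` vanishes at both end points, its derivative has one more alternation. -/
theorem AltSeq.deriv_of_zero {a b : ℝ} {f f' : ℝ → ℝ} (hd : ∀ z, HasDerivAt f (f' z) z)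
    (ha : f a = 0) (hb : f b = 0) {k : ℕ} {s : ℝ}
    (h : AltSeq a f (k + 1) s b) : AltSeq a f' (k + 2) (-s) b := by
  have hc : Continuous f := continuous_iff_continuousAt.2 fun z => (hd z).continuousAt
  have hd' : ∀ z, HasDerivWithinAt f (f' z) (Set.Ioi z) z := fun z => (hd z).hasDerivWithinAt
  obtain ⟨x, hax, hxb, hx, h'⟩ := h
  -- The zero at `a` gives an additional sign of `f'` before the first point, hence `j := 1`.
  have h1 := AltSeq.right_deriv_aux (f' := f') hc.continuousOn (fun z _ => hd' z) (j := 1)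
    (fun s y hy hs => by
      have hay : a < y := lt_of_le_of_ne hy.1 (by rintro rfl; simp [ha] at hs)
      obtain ⟨z, hz, hz'⟩ := exists_right_deriv_pos (s := s) hay hc.continuousOn
        (fun z _ => hd' z) (by simpa [ha] using hs)
      exact ⟨z, hz.1, hz.2, hz', trivial⟩) ⟨hax, hxb⟩ hx h'
  -- The zero at `b` gives another one, of sign `-s`, after the last point.
  obtain ⟨z, hz, hz'⟩ := exists_right_deriv_pos (s := -s) hxb hc.continuousOn
    (fun z _ => hd' z) (by rw [hb]; linarith)
  refine ⟨z, hax.trans hz.1, hz.2, hz', ?_⟩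
  rw [neg_neg, add_comm]
  exact h1.mono hz.1

/-! ### Breakpoints, piecewise polynomials and the upper bound for alternations. -/

/-- The breakpoints of a mesh as a sequence, constant after the last one. -/
def Mesh.node {a b : ℝ} (T : Mesh a b) (j : ℕ) : ℝ := T.x ⟨min j T.n, by omega⟩

theorem Mesh.node_zero (T : Mesh a b) : T.node 0 = a := by
  refine Eq.trans ?_ T.left
  unfold Mesh.node; congr 1

theorem Mesh.node_of_le (T : Mesh a b) {j : ℕ} (h : T.n ≤ j) : T.node j = b := by
  refine Eq.trans ?_ T.right
  unfold Mesh.node; congr 1; ext; simp [h]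

theorem Mesh.node_mono (T : Mesh a b) : Monotone T.node := fun i j hij =>
  T.strictMono.monotone (by simp only [Fin.mk_le_mk]; omega)

theorem Mesh.node_lt (T : Mesh a b) {i j : ℕ} (hij : i < j) (hi : i < T.n) :
    T.node i < T.node j :=
  T.strictMono (by simp only [Fin.mk_lt_mk]; omega)

theorem Mesh.le_node (T : Mesh a b) (j : ℕ) : a ≤ T.node j :=
  T.node_zero.symm.le.trans (T.node_mono (Nat.zero_le _))

theorem Mesh.node_le (T : Mesh a b) (j : ℕ) : T.node j ≤ b :=
  (T.node_mono (le_max_right T.n j)).trans (T.node_of_le (le_max_left _ _)).le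

theorem Mesh.n_pos (T : Mesh a b) (hab : a < b) : 0 < T.n := by
  by_contra h
  have := T.node_of_le (j := 0) (by omega)
  rw [T.node_zero] at this
  exact hab.ne this

/-- Piecewise polynomials of degree `r` of maximal smoothness on `[a, b)`, described through their
successive right derivatives. -/
def IsPiecewise (T : Mesh a b) : ℕ → (ℝ → ℝ) → Prop
  | 0, f => ∀ e < T.n, ∀ x ∈ Set.Ico (T.node e) (T.node (e + 1)), f x = f (T.node e)
  | r + 1, f => ContinuousOn f (Set.Ico a b) ∧ ∃ g, IsPiecewise T r g ∧
      ∀ x ∈ Set.Ico a b, HasDerivWithinAt f (g x) (Set.Ioi x) x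

theorem IsPiecewise.zero (T : Mesh a b) (r : ℕ) : IsPiecewise T r (fun _ => 0) := by
  induction r with
  | zero => exact fun _ _ _ _ => rfl
  | succ r ih => exact ⟨continuousOn_const, _, ih, fun _ _ => hasDerivWithinAt_const _ _ _⟩

theorem IsPiecewise.add {T : Mesh a b} {r : ℕ} {f g : ℝ → ℝ} (hf : IsPiecewise T r f)
    (hg : IsPiecewise T r g) : IsPiecewise T r (fun x => f x + g x) := by
  induction r generalizing f g with
  | zero => intro e he x hx; simp only [hf e he x hx, hg e he x hx]
  | succ r ih =>
    obtain ⟨hf, f', hf', hfd⟩ := hf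
    obtain ⟨hg, g', hg', hgd⟩ := hg
    exact ⟨hf.add hg, _, ih hf' hg', fun x hx => (hfd x hx).add (hgd x hx)⟩

theorem IsPiecewise.const_mul {T : Mesh a b} {r : ℕ} {f : ℝ → ℝ} (c : ℝ)
    (hf : IsPiecewise T r f) : IsPiecewise T r (fun x => c * f x) := by
  induction r generalizing f with
  | zero => intro e he x hx; simp only [hf e he x hx]
  | succ r ih =>
    obtain ⟨hf, f', hf', hfd⟩ := hf
    exact ⟨hf.const_mul c, _, ih hf', fun x hx => (hfd x hx).const_mul c⟩

theorem IsPiecewise.sum {T : Mesh a b} {r : ℕ} {ι : Type*} (s : Finset ι) {f : ι → ℝ → ℝ}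
    (hf : ∀ i ∈ s, IsPiecewise T r (f i)) : IsPiecewise T r (fun x => ∑ i ∈ s, f i x) := by
  classical
  induction s using Finset.induction_on with
  | empty => simpa using IsPiecewise.zero T r
  | insert i s hi ih =>
    simp only [Finset.sum_insert hi]
    exact (hf i (by simp)).add (ih fun j hj => hf j (by simp [hj]))

theorem eventuallyEq_nhdsGT_of_eqOn_Ico {f g : ℝ → ℝ} (h : Set.EqOn f g (Set.Ico a b)) {x : ℝ}
    (hx : x ∈ Set.Ico a b) : f =ᶠ[nhdsWithin x (Set.Ioi x)] g := by
  filter_upwards [Ioo_mem_nhdsGT hx.2] with y hy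
  exact h ⟨hx.1.trans hy.1.le, hy.2⟩

theorem IsPiecewise.congr {T : Mesh a b} {r : ℕ} {f g : ℝ → ℝ} (hf : IsPiecewise T r f)
    (h : Set.EqOn g f (Set.Ico a b)) : IsPiecewise T r g := by
  cases r with
  | zero =>
    intro e he x hx
    have hlt := T.node_lt (Nat.lt_succ_self e) he
    rw [h ⟨(T.le_node e).trans hx.1, hx.2.trans_le (T.node_le _)⟩,
      h ⟨T.le_node e, hlt.trans_le (T.node_le _)⟩, hf e he x hx]
  | succ r =>
    obtain ⟨hc, f', hf', hd⟩ := hf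
    exact ⟨hc.congr h, f', hf', fun x hx =>
      (hd x hx).congr_of_eventuallyEq (eventuallyEq_nhdsGT_of_eqOn_Ico h hx) (h hx)⟩

open Classical in
-- Each element carries at most one point of an alternation, and none where the constant is zero.
theorem AltSeq.le_card_of_const {T : Mesh a b} {f : ℝ → ℝ} (hf : IsPiecewise T 0 f) {j : ℕ}
    (hj : j ≤ T.n) {k : ℕ} {s : ℝ} (h : AltSeq a f k s (T.node j)) :
    k ≤ ((Finset.range j).filter fun e => f (T.node e) ≠ 0).card := by
  induction j generalizing k s with
  | zero =>
    cases k with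
    | zero => simp
    | succ k =>
      obtain ⟨x, h1, h2, _⟩ := h
      rw [T.node_zero] at h2
      exact absurd h2 (not_lt.2 h1)
  | succ j ih =>
    cases k with
    | zero => simp
    | succ k =>
      have hle : ((Finset.range j).filter fun e => f (T.node e) ≠ 0).card ≤
          ((Finset.range (j + 1)).filter fun e => f (T.node e) ≠ 0).card :=
        Finset.card_le_card (Finset.filter_subset_filter _ (by simp))
      obtain ⟨x, h1, h2, h3, h4⟩ := h
      by_cases hx : x < T.node j
      · exact (ih (k := k + 1) (s := s) (by omega) ⟨x, h1, hx, h3, h4⟩).trans hle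
      · push Not at hx
        have e1 : f x = f (T.node j) := hf j (by omega) x ⟨hx, h2⟩
        rw [e1] at h3
        have hne : f (T.node j) ≠ 0 := by rintro h0; simp [h0] at h3
        -- The preceding point has the opposite sign, so it cannot lie in the same element.
        have h5 : AltSeq a f k (-s) (T.node j) := by
          cases k with
          | zero => trivial
          | succ k =>
            obtain ⟨y, g1, g2, g3, g4⟩ := h4
            refine ⟨y, g1, ?_, g3, g4⟩
            by_contra hy
            push Not at hy
            rw [hf j (by omega) y ⟨hy, g2.trans h2⟩] at g3
            linarith
        have := ih (by omega) h5
        rw [Finset.range_add_one, Finset.filter_insert, if_pos hne,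
          Finset.card_insert_of_notMem (by simp)]
        omega

/-- The number of alternations of a piecewise polynomial is bounded by the number of elements
on which its top derivative does not vanish. -/
theorem IsPiecewise.exists_finset {T : Mesh a b} {r : ℕ} {f : ℝ → ℝ}
    (hf : IsPiecewise T r f) : ∃ E ⊆ Finset.range T.n,
      (∀ k s, AltSeq a f k s b → k ≤ E.card + r) ∧
      ∀ e ∈ E, ∀ c d, c < d → Set.Ioo c d ⊆ Set.Ioo (T.node e) (T.node (e + 1)) →
        ∃ x ∈ Set.Ioo c d, f x ≠ 0 := by
  classical
  induction r generalizing f with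
  | zero =>
    refine ⟨(Finset.range T.n).filter fun e => f (T.node e) ≠ 0, Finset.filter_subset _ _,
      fun k s h => ?_, fun e he c d hcd hs => ?_⟩
    · rw [← T.node_of_le le_rfl] at h
      exact AltSeq.le_card_of_const hf le_rfl h
    · rw [Finset.mem_filter, Finset.mem_range] at he
      obtain ⟨x, hx⟩ := Set.nonempty_Ioo.2 hcd
      exact ⟨x, hx, by rw [hf e he.1 x (Set.Ioo_subset_Ico_self (hs hx))]; exact he.2⟩
  | succ r ih =>
    obtain ⟨hc, g, hg, hd⟩ := hf
    obtain ⟨E, hE, h1, h2⟩ := ih hg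
    refine ⟨E, hE, fun k s h => ?_, fun e he c d hcd hs => ?_⟩
    · cases k with
      | zero => simp
      | succ k => have := h1 k s (h.right_deriv hc hd); omega
    · obtain ⟨x, hx, hgx⟩ := h2 e he c d hcd hs
      by_contra! h0
      apply hgx
      have hx' : x ∈ Set.Ico a b :=
        ⟨(T.le_node e).trans (hs hx).1.le, (hs hx).2.trans_le (T.node_le _)⟩
      -- If `f` vanished on the subinterval, so would its right derivative `g`, against the
      -- induction hypothesis.
      have hev : f =ᶠ[nhdsWithin x (Set.Ioi x)] fun _ => 0 := by
        filter_upwards [Ioo_mem_nhdsGT hx.2] with y hy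
        exact h0 y ⟨hx.1.trans hy.1, hy.2⟩
      have hz : HasDerivWithinAt f 0 (Set.Ioi x) x :=
        (hasDerivWithinAt_const x _ (0 : ℝ)).congr_of_eventuallyEq hev (h0 x hx)
      exact (uniqueDiffWithinAt_Ioi x).eq_deriv _ (hd x hx') hz

/-! ### Derivatives and end values of B-splines. -/

/-- With half-open supports, a spline of degree 0 is constant immediately to the right of every
point, breakpoints included. -/
theorem hasDerivWithinAt_bspline_zero (t : ℕ → ℝ) (i : ℕ) (x : ℝ) :
    HasDerivWithinAt (bspline t 0 i) 0 (Set.Ioi x) x := by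
  have key : ∃ y > x, ∀ z ∈ Set.Ico x y, bspline t 0 i z = bspline t 0 i x := by
    simp only [bspline]
    by_cases h1 : x < t i
    · refine ⟨t i, h1, fun z hz => ?_⟩
      rw [if_neg (fun h => absurd h.1 (not_le.2 hz.2)), if_neg (fun h => absurd h.1 (not_le.2 h1))]
    · push Not at h1
      by_cases h2 : x < t (i + 1)
      · refine ⟨t (i + 1), h2, fun z hz => ?_⟩
        rw [if_pos ⟨h1.trans hz.1, hz.2⟩, if_pos ⟨h1, h2⟩]
      · refine ⟨x + 1, by simp, fun z hz => ?_⟩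
        rw [if_neg (fun h => h2 (hz.1.trans_lt h.2)), if_neg (fun h => h2 h.2)]
  obtain ⟨y, hy, h⟩ := key
  refine (hasDerivWithinAt_const x _ (bspline t 0 i x)).congr_of_eventuallyEq ?_ rfl
  filter_upwards [Ioo_mem_nhdsGT hy] with z hz
  exact h z ⟨hz.1.le, hz.2⟩

/-- The right derivative of the B-spline of degree `d + 1`. -/
noncomputable def bsplineDeriv (t : ℕ → ℝ) (d i : ℕ) (x : ℝ) : ℝ :=
  (d + 1) * (bspline t d i x / (t (i + d + 1) - t i) -
    bspline t d (i + 1) x / (t (i + d + 2) - t (i + 1)))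

/-- Induction on the degree: differentiate the recursion by the product rule, insert the formula one
degree lower and regroup. -/
theorem hasDerivWithinAt_bspline {t : ℕ → ℝ} (ht : Monotone t) (d i : ℕ) (x : ℝ) :
    HasDerivWithinAt (bspline t (d + 1) i) (bsplineDeriv t d i x) (Set.Ioi x) x := by
  have key : ∀ (d i : ℕ) (u v : ℝ), HasDerivWithinAt (bspline t d i) u (Set.Ioi x) x →
      HasDerivWithinAt (bspline t d (i + 1)) v (Set.Ioi x) x →
      HasDerivWithinAt (bspline t (d + 1) i)
        (1 / (t (i + d + 1) - t i) * bspline t d i x + (x - t i) / (t (i + d + 1) - t i) * u +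
          (-1 / (t (i + d + 2) - t (i + 1)) * bspline t d (i + 1) x +
            (t (i + d + 2) - x) / (t (i + d + 2) - t (i + 1)) * v)) (Set.Ioi x) x := by
    intro d i u v hu hv
    have h1 : HasDerivWithinAt (fun x => (x - t i) / (t (i + d + 1) - t i))
        (1 / (t (i + d + 1) - t i)) (Set.Ioi x) x :=
      ((hasDerivWithinAt_id x _).sub_const _).div_const _
    have h2 : HasDerivWithinAt (fun x => (t (i + d + 2) - x) / (t (i + d + 2) - t (i + 1)))
        (-1 / (t (i + d + 2) - t (i + 1))) (Set.Ioi x) x :=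
      ((hasDerivWithinAt_id x _).const_sub _).div_const _
    exact (h1.mul hu).add (h2.mul hv)
  induction d generalizing i with
  | zero =>
    convert key 0 i 0 0 (hasDerivWithinAt_bspline_zero t i x)
      (hasDerivWithinAt_bspline_zero t (i + 1) x) using 1
    simp only [bsplineDeriv]
    push_cast
    ring
  | succ d ih =>
    convert key (d + 1) i _ _ (ih i) (ih (i + 1)) using 1
    simp only [bsplineDeriv]
    rw [show bspline t (d + 1) i x = (x - t i) / (t (i + d + 1) - t i) * bspline t d i x +
        (t (i + d + 2) - x) / (t (i + d + 2) - t (i + 1)) * bspline t d (i + 1) x from rfl,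
      show bspline t (d + 1) (i + 1) x =
        (x - t (i + 1)) / (t (i + 1 + d + 1) - t (i + 1)) * bspline t d (i + 1) x +
        (t (i + 1 + d + 2) - x) / (t (i + 1 + d + 2) - t (i + 1 + 1)) *
          bspline t d (i + 1 + 1) x from rfl]
    have e1 : i + (d + 1) + 1 = i + d + 2 := by ring
    have e2 : i + (d + 1) + 2 = i + d + 3 := by ring
    have e3 : i + 1 + d + 1 = i + d + 2 := by ring
    have e4 : i + 1 + d + 2 = i + d + 3 := by ring
    have e5 : i + 1 + 1 = i + 2 := by ring
    rw [e1, e2, e3, e4, e5]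
    have m1 : t i ≤ t (i + 1) := ht (by omega)
    have m2 : t (i + 1) ≤ t (i + d + 2) := ht (by omega)
    have m3 : t (i + d + 2) ≤ t (i + d + 3) := ht (by omega)
    push_cast
    -- Coinciding knots make the middle denominator zero, and its quotients zero by convention.
    -- Otherwise the three longer spans are nonzero; the remaining two may still vanish, so their
    -- inverses stay opaque.
    rcases m2.eq_or_lt with h | h
    · rw [h, sub_self]; simp only [div_zero, zero_mul, add_zero, zero_add, zero_sub, sub_zero]
      ring
    · have n1 : t (i + d + 2) - t i ≠ 0 := by intro h0; linarith
      have n2 : t (i + d + 3) - t (i + 1) ≠ 0 := by intro h0; linarith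
      have n3 : t (i + d + 2) - t (i + 1) ≠ 0 := by intro h0; linarith
      generalize bspline t d i x = A
      generalize bspline t d (i + 1) x = B
      generalize bspline t d (i + 2) x = C
      simp only [div_eq_mul_inv]
      generalize hP : (t (i + d + 1) - t i)⁻¹ = P
      generalize hR : (t (i + d + 3) - t (i + 2))⁻¹ = R
      field_simp
      ring

theorem Mesh.openKnots_eq (T : Mesh a b) (r j : ℕ) : T.openKnots r j = T.node (j - r) := rfl

theorem Mesh.openKnots_mono (T : Mesh a b) (r : ℕ) : Monotone (T.openKnots r) := fun i j hij =>
  T.node_mono (by omega)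

/-- One more repetition of the end knots only shifts the indices. Derivatives of splines of degree
`r + 1` can thus be expressed in the degree `r` basis with its own open knots. -/
theorem bspline_shift (T : Mesh a b) (r d i : ℕ) (x : ℝ) :
    bspline (T.openKnots (r + 1)) d (i + 1) x = bspline (T.openKnots r) d i x := by
  have h : ∀ j, T.openKnots (r + 1) (j + 1) = T.openKnots r j := fun j => by
    rw [T.openKnots_eq, T.openKnots_eq]; congr 1; omega
  induction d generalizing i with
  | zero => simp only [bspline, h]
  | succ d ih =>
    simp only [bspline, ih, h]
    rw [show i + 1 + d = i + d + 1 by ring]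

/-- The value at the left end point. -/
theorem bspline_left (T : Mesh a b) (hab : a < b) (r d i : ℕ) :
    bspline (T.openKnots r) d i a = if i + d = r then 1 else 0 := by
  have hn := T.n_pos hab
  have hl : ∀ j ≤ r, T.openKnots r j = a := fun j hj => by
    rw [T.openKnots_eq, Nat.sub_eq_zero_of_le hj, T.node_zero]
  have hr : ∀ j, r < j → a < T.openKnots r j := fun j hj => by
    rw [T.openKnots_eq]
    exact T.node_zero.symm.le.trans_lt (T.node_lt (by omega) hn)
  induction d generalizing i with
  | zero =>
    simp only [bspline, add_zero]
    refine if_congr ⟨fun h => ?_, fun h => ?_⟩ rfl rfl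
    · by_contra hne
      rcases lt_or_gt_of_ne hne with h' | h'
      · rw [hl (i + 1) (by omega)] at h; exact lt_irrefl _ h.2
      · exact absurd h.1 (not_le.2 (hr i h'))
    · exact ⟨(hl i h.le).le, hr _ (by omega)⟩
  | succ d ih =>
    simp only [bspline, ih]
    by_cases h1 : i + d = r
    · rw [hl i (by omega), if_neg (by omega : ¬ i + 1 + d = r),
        if_neg (by omega : ¬ i + (d + 1) = r)]
      simp
    · rw [if_neg h1]
      by_cases h2 : i + 1 + d = r
      · rw [if_pos h2, if_pos (by omega), hl (i + 1) (by omega),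
          div_self (by have := hr (i + d + 2) (by omega); linarith)]
        simp
      · rw [if_neg h2, if_neg (by omega)]; simp

/-- B-splines of positive degree have a continuous version on `[a, b]`, and its value at the
right end point. -/
theorem exists_continuous_bspline (T : Mesh a b) (hab : a < b) (r d i : ℕ) :
    ∃ w : ℝ → ℝ, Continuous w ∧ Set.EqOn w (bspline (T.openKnots r) (d + 1) i) (Set.Ico a b) ∧
      w b = if i + 1 = T.n + r then 1 else 0 := by
  have hn := T.n_pos hab
  have hm := T.openKnots_mono r
  -- Since the knots continue with the value `b`, the spline with end value 1 has the same index in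
  -- every positive degree.
  have hr : ∀ j, T.n + r ≤ j → T.openKnots r j = b := fun j hj => by
    rw [T.openKnots_eq, T.node_of_le (by omega)]
  have hlt : ∀ j, j < T.n + r → T.openKnots r j < b := fun j hj => by
    rw [T.openKnots_eq]
    exact (T.node_lt (j := T.n) (by omega) (by omega)).trans_le (T.node_le _)
  have hstrict : ∀ j, r ≤ j → j < T.n + r → T.openKnots r j < T.openKnots r (j + 1) :=
    fun j hj hj' => T.node_lt (by omega) (by omega)
  have hl : ∀ j ≤ r, T.openKnots r j = a := fun j hj => by
    rw [T.openKnots_eq, Nat.sub_eq_zero_of_le hj, T.node_zero]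
  generalize T.openKnots r = t at *
  induction d generalizing i with
  | zero =>
    have m1 : t i ≤ t (i + 1) := hm (by omega)
    have m2 : t (i + 1) ≤ t (i + 2) := hm (by omega)
    simp only [bspline, add_zero, add_assoc, one_add_one_eq_two]
    -- In degree one this is a hat function, either half of which may be lost to a repeated knot.
    -- Clipping with `max` and `min` makes continuity immediate.
    rcases m1.eq_or_lt with h1 | h1
    · rcases m2.eq_or_lt with h2 | h2
      · refine ⟨fun _ => 0, continuous_const, fun x hx => ?_, ?_⟩
        · simp [h1, h2]
        · rw [if_neg]; intro h
          have := hlt i (by omega)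
          rw [hr (i + 1) (by omega)] at h1
          linarith
      · have hi : ¬ (r ≤ i ∧ i < T.n + r) := fun h => (hstrict i h.1 h.2).ne h1
        have hi2 : i + 1 < T.n + r := by
          by_contra h
          rw [hr (i + 1) (by omega), hr (i + 2) (by omega)] at h2
          exact lt_irrefl _ h2
        have ha1 : t (i + 1) = a := hl _ (by omega)
        refine ⟨fun x => max 0 ((t (i + 2) - x) / (t (i + 2) - t (i + 1))), by fun_prop,
          fun x hx => ?_, ?_⟩
        · beta_reduce
          have hx1 : t (i + 1) ≤ x := by rw [ha1]; exact hx.1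
          rw [if_neg (by rintro ⟨g1, g2⟩; linarith)]
          by_cases hx2 : x < t (i + 2)
          · rw [if_pos ⟨hx1, hx2⟩]
            have : 0 ≤ (t (i + 2) - x) / (t (i + 2) - t (i + 1)) :=
              div_nonneg (by linarith) (by linarith)
            simp [this]
          · rw [if_neg (by tauto)]
            have : (t (i + 2) - x) / (t (i + 2) - t (i + 1)) ≤ 0 :=
              div_nonpos_of_nonpos_of_nonneg (by linarith) (by linarith)
            simp [this]
        · rw [if_neg (by omega)]
          have hb2 : t (i + 2) ≤ b := by rw [← hr (T.n + r + (i + 2)) (by omega)]; exact hm (by omega)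
          have : (t (i + 2) - b) / (t (i + 2) - t (i + 1)) ≤ 0 :=
            div_nonpos_of_nonpos_of_nonneg (by linarith) (by linarith)
          simp [this]
    · have hi1 : i < T.n + r := by
        by_contra h
        rw [hr i (by omega), hr (i + 1) (by omega)] at h1
        exact lt_irrefl _ h1
      have hi2 : r ≤ i := by
        by_contra h
        rw [hl i (by omega), hl (i + 1) (by omega)] at h1
        exact lt_irrefl _ h1
      rcases m2.eq_or_lt with h2 | h2
      · have hb1 : i + 1 = T.n + r := by
          by_contra h
          exact (hstrict (i + 1) (by omega) (by omega)).ne h2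
        have hb : t (i + 1) = b := hr _ hb1.ge
        refine ⟨fun x => max 0 ((x - t i) / (t (i + 1) - t i)), by fun_prop, fun x hx => ?_, ?_⟩
        · beta_reduce
          have hx1 : x < t (i + 1) := by rw [hb]; exact hx.2
          rw [if_neg (by rintro ⟨g1, g2⟩; linarith : ¬ (t (i + 1) ≤ x ∧ x < t (i + 2)))]
          by_cases hx2 : t i ≤ x
          · rw [if_pos ⟨hx2, hx1⟩]
            have : 0 ≤ (x - t i) / (t (i + 1) - t i) := div_nonneg (by linarith) (by linarith)
            simp [this]
          · rw [if_neg (by tauto)]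
            have : (x - t i) / (t (i + 1) - t i) ≤ 0 :=
              div_nonpos_of_nonpos_of_nonneg (by linarith) (by linarith)
            simp [this]
        · have : b - t i ≠ 0 := by intro h0; linarith
          rw [if_pos hb1, hb]; simp [div_self this]
      · have hb1 : i + 1 < T.n + r := by
          by_contra h
          rw [hr (i + 1) (by omega), hr (i + 2) (by omega)] at h2
          exact lt_irrefl _ h2
        refine ⟨fun x => max 0 (min ((x - t i) / (t (i + 1) - t i))
          ((t (i + 2) - x) / (t (i + 2) - t (i + 1)))), by fun_prop, fun x hx => ?_, ?_⟩
        · beta_reduce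
          have d1 : 0 < t (i + 1) - t i := by linarith
          have d2 : 0 < t (i + 2) - t (i + 1) := by linarith
          by_cases c1 : x < t i
          · rw [if_neg (by rintro ⟨g1, g2⟩; linarith), if_neg (by rintro ⟨g1, g2⟩; linarith)]
            have : (x - t i) / (t (i + 1) - t i) ≤ 0 :=
              div_nonpos_of_nonpos_of_nonneg (by linarith) d1.le
            simp [this]
          push Not at c1
          by_cases c2 : x < t (i + 1)
          · rw [if_pos ⟨c1, c2⟩, if_neg (by rintro ⟨g1, g2⟩; linarith)]
            have g1 : 0 ≤ (x - t i) / (t (i + 1) - t i) := div_nonneg (by linarith) d1.le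
            have g2 : (x - t i) / (t (i + 1) - t i) ≤ 1 := by rw [div_le_one d1]; linarith
            have g3 : 1 ≤ (t (i + 2) - x) / (t (i + 2) - t (i + 1)) := by
              rw [one_le_div d2]; linarith
            simp [min_eq_left (g2.trans g3), g1]
          push Not at c2
          by_cases c3 : x < t (i + 2)
          · rw [if_neg (by rintro ⟨g1, g2⟩; linarith), if_pos ⟨c2, c3⟩]
            have g1 : 0 ≤ (t (i + 2) - x) / (t (i + 2) - t (i + 1)) :=
              div_nonneg (by linarith) d2.le
            have g2 : (t (i + 2) - x) / (t (i + 2) - t (i + 1)) ≤ 1 := by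
              rw [div_le_one d2]; linarith
            have g3 : 1 ≤ (x - t i) / (t (i + 1) - t i) := by rw [one_le_div d1]; linarith
            simp [min_eq_right (g2.trans g3), g1]
          · rw [if_neg (by rintro ⟨g1, g2⟩; linarith),
              if_neg (show ¬ (t (i + 1) ≤ x ∧ x < t (i + 2)) from fun h => c3 h.2)]
            have : (t (i + 2) - x) / (t (i + 2) - t (i + 1)) ≤ 0 :=
              div_nonpos_of_nonpos_of_nonneg (by linarith) d2.le
            simp [this]
        · rw [if_neg (by omega)]
          have hb2 : t (i + 2) ≤ b := by rw [← hr (T.n + r + (i + 2)) (by omega)]; exact hm (by omega)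
          have : (t (i + 2) - b) / (t (i + 2) - t (i + 1)) ≤ 0 :=
            div_nonpos_of_nonpos_of_nonneg (by linarith) (by linarith)
          simp [this]
  | succ d ih =>
    obtain ⟨u, hu, hu', hub⟩ := ih i
    obtain ⟨v, hv, hv', hvb⟩ := ih (i + 1)
    refine ⟨fun x => (x - t i) / (t (i + (d + 1) + 1) - t i) * u x +
      (t (i + (d + 1) + 2) - x) / (t (i + (d + 1) + 2) - t (i + 1)) * v x, by fun_prop,
      fun x hx => ?_, ?_⟩
    · simp only [hu' hx, hv' hx]; rfl
    · simp only [hub, hvb]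
      by_cases h1 : i + 1 = T.n + r
      · rw [if_pos h1, if_neg (by omega), hr (i + (d + 1) + 1) (by omega),
          div_self (by have := hlt i (by omega); linarith)]
        simp
      · rw [if_neg h1]
        by_cases h2 : i + 1 + 1 = T.n + r
        · rw [hr (i + (d + 1) + 2) (by omega)]; simp
        · rw [if_neg h2]; simp

theorem isPiecewise_bspline (T : Mesh a b) (hab : a < b) (r d i : ℕ) :
    IsPiecewise T d (bspline (T.openKnots r) d i) := by
  induction d generalizing i with
  | zero =>
    intro e he x hx
    simp only [bspline]
    refine if_congr ?_ rfl rfl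
    simp only [T.openKnots_eq]
    refine and_congr ⟨fun h => ?_, fun h => h.trans hx.1⟩ ⟨fun h => hx.1.trans_lt h, fun h => ?_⟩
    · by_contra h'
      push Not at h'
      have : e < i - r := by
        by_contra h''; exact absurd (T.node_mono (not_lt.1 h'')) (not_le.2 h')
      exact absurd (hx.2.trans_le ((T.node_mono this).trans h)) (lt_irrefl _)
    · have : e < i + 1 - r := by
        by_contra h''; exact absurd (T.node_mono (not_lt.1 h'')) (not_le.2 h)
      exact hx.2.trans_le (T.node_mono this)
  | succ d ih =>
    obtain ⟨w, hw, hw', -⟩ := exists_continuous_bspline T hab r d i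
    refine ⟨hw.continuousOn.congr hw'.symm, bsplineDeriv (T.openKnots r) d i, ?_,
      fun x _ => hasDerivWithinAt_bspline (T.openKnots_mono r) d i x⟩
    have := (((ih i).const_mul (1 / (T.openKnots r (i + d + 1) - T.openKnots r i))).add
      ((ih (i + 1)).const_mul
        (-1 / (T.openKnots r (i + d + 2) - T.openKnots r (i + 1))))).const_mul ((d : ℝ) + 1)
    refine this.congr fun x _ => ?_
    simp only [bsplineDeriv]
    ring

/-! ### Integration by parts, moments and antiderivatives. -/

theorem intervalIntegrable_bspline_mul (t : ℕ → ℝ) (hab : a < b) (d i : ℕ) {g : ℝ → ℝ}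
    (hg : Continuous g) :
    IntervalIntegrable (fun x => bspline t d i x * g x) volume a b := by
  rw [intervalIntegrable_iff_integrableOn_Ioo_of_le hab.le]
  obtain ⟨C, hC⟩ := (isCompact_Icc (a := a) (b := b)).exists_bound_of_continuousOn
    hg.continuousOn
  have h1 : Integrable (bspline t d i) (volume.restrict (Set.Ioo a b)) :=
    (memLp_bspline t a b d i).integrable (by norm_num)
  exact h1.mul_bdd (c := C) hg.aestronglyMeasurable
    (ae_restrict_of_forall_mem measurableSet_Ioo
      fun x hx => hC x (Set.Ioo_subset_Icc_self hx))

/-- Integration by parts against a B-spline. -/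
theorem integral_bspline_mul_deriv (T : Mesh a b) (hab : a < b) (r i : ℕ) {R Q : ℝ → ℝ}
    (hR : ∀ x, HasDerivAt R (Q x) x) (hQ : Continuous Q) :
    ∫ x in a..b, bspline (T.openKnots (r + 1)) (r + 1) i x * Q x =
      (if i = T.n + r then R b else 0) - (if i = 0 then R a else 0) -
        ∫ x in a..b, bsplineDeriv (T.openKnots (r + 1)) r i x * R x := by
  -- The B-spline itself is zero at `b` by the half-open convention; the continuous version supplies
  -- the correct boundary term.
  obtain ⟨w, hw, hwe, hwb⟩ := exists_continuous_bspline T hab (r + 1) r i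
  have hRc : Continuous R := continuous_iff_continuousAt.2 fun z => (hR z).continuousAt
  have i1 := intervalIntegrable_bspline_mul (T.openKnots (r + 1)) hab (r + 1) i hQ
  have i2 : IntervalIntegrable (fun x => bsplineDeriv (T.openKnots (r + 1)) r i x * R x)
      volume a b := by
    have := (((intervalIntegrable_bspline_mul (T.openKnots (r + 1)) hab r i hRc).div_const
      (T.openKnots (r + 1) (i + r + 1) - T.openKnots (r + 1) i)).sub
      ((intervalIntegrable_bspline_mul (T.openKnots (r + 1)) hab r (i + 1) hRc).div_const
      (T.openKnots (r + 1) (i + r + 2) - T.openKnots (r + 1) (i + 1)))).const_mul ((r : ℝ) + 1)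
    refine this.congr (fun x _ => ?_)
    simp only [bsplineDeriv]
    ring
  have key := intervalIntegral.integral_eq_sub_of_hasDeriv_right (a := a) (b := b)
    (f := fun x => w x * R x)
    (f' := fun x => bsplineDeriv (T.openKnots (r + 1)) r i x * R x +
      bspline (T.openKnots (r + 1)) (r + 1) i x * Q x) (hw.mul hRc).continuousOn
    (fun x hx => by
      rw [min_eq_left hab.le, max_eq_right hab.le] at hx
      have hx' := Set.Ioo_subset_Ico_self hx
      have h1 : HasDerivWithinAt w (bsplineDeriv (T.openKnots (r + 1)) r i x) (Set.Ioi x) x :=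
        (hasDerivWithinAt_bspline (T.openKnots_mono (r + 1)) r i x).congr_of_eventuallyEq
          (eventuallyEq_nhdsGT_of_eqOn_Ico hwe hx') (hwe hx')
      rw [← hwe hx']
      exact h1.mul (hR x).hasDerivWithinAt) (i2.add i1)
  rw [intervalIntegral.integral_add i2 i1] at key
  have ha : w a = if i = 0 then 1 else 0 := by
    rw [hwe ⟨le_rfl, hab⟩, bspline_left T hab]
    exact if_congr (by omega) rfl rfl
  have hb : w b = if i = T.n + r then 1 else 0 := by
    rw [hwb]
    exact if_congr (by omega) rfl rfl
  rw [ha, hb, ite_mul, ite_mul, one_mul, one_mul, zero_mul, zero_mul] at key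
  linarith

/-- The moments of `R` against the B-splines of degree `r`, normalized by the support length. -/
noncomputable def moment (T : Mesh a b) (r : ℕ) (R : ℝ → ℝ) (i : ℕ) : ℝ :=
  (∫ x in a..b, bspline (T.openKnots r) r i x * R x) /
    (T.openKnots r (i + r + 1) - T.openKnots r i)

/-- One index past the last B-spline the support length is zero. The default value 0 lets the
difference formula hold at the last index too. -/
theorem moment_last (T : Mesh a b) (r : ℕ) (R : ℝ → ℝ) : moment T r R (T.n + r) = 0 := by
  unfold moment
  rw [T.openKnots_eq, T.openKnots_eq, T.node_of_le (by omega), T.node_of_le (by omega), sub_self,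
    div_zero]

/-- The first B-spline starts at a full-multiplicity knot, so one of the two terms of its derivative
drops out and a single moment remains. -/
theorem integral_bspline_zero_mul (T : Mesh a b) (hab : a < b) (r : ℕ) {R Q : ℝ → ℝ}
    (hR : ∀ x, HasDerivAt R (Q x) x) (hQ : Continuous Q) :
    ∫ x in a..b, bspline (T.openKnots (r + 1)) (r + 1) 0 x * Q x =
      -R a + (r + 1) * moment T r R 0 := by
  have hn := T.n_pos hab
  rw [integral_bspline_mul_deriv T hab r 0 hR hQ, if_neg (by omega), if_pos rfl]
  have : ∀ x, bsplineDeriv (T.openKnots (r + 1)) r 0 x * R x = -(r + 1) *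
      ((bspline (T.openKnots r) r 0 x * R x) /
        (T.openKnots r (0 + r + 1) - T.openKnots r 0)) := fun x => by
    simp only [bsplineDeriv, bspline_shift]
    have e1 : T.openKnots (r + 1) (0 + r + 1) - T.openKnots (r + 1) 0 = 0 := by
      simp [T.openKnots_eq]
    have e2 : T.openKnots (r + 1) (0 + r + 2) - T.openKnots (r + 1) (0 + 1) =
        T.openKnots r (0 + r + 1) - T.openKnots r 0 := by
      simp only [T.openKnots_eq]; congr 2 <;> omega
    rw [e1, e2]
    ring
  simp only [this, intervalIntegral.integral_const_mul, intervalIntegral.integral_div]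
  unfold moment
  ring

/-- The derivative is a difference of normalized splines one degree lower, so integration by parts
produces a difference of consecutive moments. -/
theorem integral_bspline_succ_mul (T : Mesh a b) (hab : a < b) (r i : ℕ) {R Q : ℝ → ℝ}
    (hR : ∀ x, HasDerivAt R (Q x) x) (hQ : Continuous Q) :
    ∫ x in a..b, bspline (T.openKnots (r + 1)) (r + 1) (i + 1) x * Q x =
      (if i + 1 = T.n + r then R b else 0) -
        (r + 1) * (moment T r R i - moment T r R (i + 1)) := by
  have hRc : Continuous R := continuous_iff_continuousAt.2 fun z => (hR z).continuousAt
  rw [integral_bspline_mul_deriv T hab r (i + 1) hR hQ, if_neg (Nat.succ_ne_zero i), sub_zero]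
  congr 1
  have : ∀ x, bsplineDeriv (T.openKnots (r + 1)) r (i + 1) x * R x = (r + 1) *
      ((bspline (T.openKnots r) r i x * R x) /
        (T.openKnots r (i + r + 1) - T.openKnots r i) -
      (bspline (T.openKnots r) r (i + 1) x * R x) /
        (T.openKnots r (i + 1 + r + 1) - T.openKnots r (i + 1))) := fun x => by
    simp only [bsplineDeriv, bspline_shift]
    have e1 : T.openKnots (r + 1) (i + 1 + r + 1) - T.openKnots (r + 1) (i + 1) =
        T.openKnots r (i + r + 1) - T.openKnots r i := by
      simp only [T.openKnots_eq]; congr 2 <;> omega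
    have e2 : T.openKnots (r + 1) (i + 1 + r + 2) - T.openKnots (r + 1) (i + 1 + 1) =
        T.openKnots r (i + 1 + r + 1) - T.openKnots r (i + 1) := by
      simp only [T.openKnots_eq]; congr 2 <;> omega
    rw [e1, e2]
    ring
  simp only [this, intervalIntegral.integral_const_mul]
  rw [intervalIntegral.integral_sub
    ((intervalIntegrable_bspline_mul _ hab _ _ hRc).div_const _)
    ((intervalIntegrable_bspline_mul _ hab _ _ hRc).div_const _),
    intervalIntegral.integral_div, intervalIntegral.integral_div]
  rfl

/-- Take `R = 1` and `Q = 0` in the two preceding formulas: one fixes the first moment, the other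
makes consecutive moments equal. -/
theorem moment_const_one (T : Mesh a b) (hab : a < b) (r i : ℕ) (hi : i < T.n + r) :
    moment T r (fun _ => 1) i = 1 / (r + 1) := by
  have hd : ∀ x : ℝ, HasDerivAt (fun _ : ℝ => (1 : ℝ)) ((fun _ => (0 : ℝ)) x) x := fun x =>
    hasDerivAt_const x _
  have hr : (r : ℝ) + 1 ≠ 0 := by positivity
  induction i with
  | zero =>
    have := integral_bspline_zero_mul T hab r hd continuous_const
    simp only [mul_zero, intervalIntegral.integral_zero] at this
    field_simp
    linarith
  | succ i ih =>
    have := integral_bspline_succ_mul T hab r i hd continuous_const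
    simp only [mul_zero, intervalIntegral.integral_zero] at this
    rw [if_neg (by omega), zero_sub, eq_comm, neg_eq_zero, mul_eq_zero, or_iff_right hr] at this
    rw [← ih (by omega)]
    linarith

/-- A function orthogonal to the interior B-splines of degree `r + 1` has an antiderivative that is
orthogonal to all B-splines of degree `r`. -/
theorem exists_antideriv_orthogonal (T : Mesh a b) (hab : a < b) (r : ℕ) {Q : ℝ → ℝ}
    (hQ : Continuous Q)
    (h : ∀ i, i + 1 < T.n + r →
      ∫ x in a..b, bspline (T.openKnots (r + 1)) (r + 1) (i + 1) x * Q x = 0) :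
    ∃ R : ℝ → ℝ, (∀ x, HasDerivAt R (Q x) x) ∧
      ∀ i < T.n + r, ∫ x in a..b, bspline (T.openKnots r) r i x * R x = 0 := by
  have hn := T.n_pos hab
  have hr : (r : ℝ) + 1 ≠ 0 := by positivity
  set R₀ : ℝ → ℝ := fun x => ∫ y in a..x, Q y with hR₀
  have hd : ∀ x, HasDerivAt R₀ (Q x) x := fun x =>
    intervalIntegral.integral_hasDerivAt_right (hQ.intervalIntegrable _ _)
      (hQ.stronglyMeasurableAtFilter _ _) hQ.continuousAt
  have hc : Continuous R₀ := continuous_iff_continuousAt.2 fun z => (hd z).continuousAt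
  have hconst : ∀ i < T.n + r, moment T r R₀ i = moment T r R₀ 0 := by
    intro i hi
    induction i with
    | zero => rfl
    | succ i ih =>
      have := integral_bspline_succ_mul T hab r i hd hQ
      rw [h i hi, if_neg (by omega), zero_sub, eq_comm, neg_eq_zero, mul_eq_zero,
        or_iff_right hr] at this
      rw [← ih (by omega)]
      linarith
  -- All moments of `R₀` agree and those of 1 equal `1 / (r + 1)`; subtracting this constant cancels
  -- them all.
  set c := (r + 1) * moment T r R₀ 0 with hcdef
  refine ⟨fun x => R₀ x - c, fun x => (hd x).sub_const _, fun i hi => ?_⟩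
  have hpos : T.openKnots r (i + r + 1) - T.openKnots r i ≠ 0 := by
    have : T.openKnots r i < T.openKnots r (i + r + 1) := T.node_lt (by omega) (by omega)
    intro h0; linarith
  have h1 := hconst i hi
  have h2 := moment_const_one T hab r i hi
  have h3 : ∫ x in a..b, bspline (T.openKnots r) r i x * (R₀ x - c) =
      (∫ x in a..b, bspline (T.openKnots r) r i x * R₀ x) -
        (∫ x in a..b, bspline (T.openKnots r) r i x * 1) * c := by
    rw [← intervalIntegral.integral_mul_const, ← intervalIntegral.integral_sub
      (intervalIntegrable_bspline_mul _ hab _ _ hc)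
      ((intervalIntegrable_bspline_mul _ hab _ _ continuous_const).mul_const _)]
    congr 1; ext x; ring
  unfold moment at h1 h2
  rw [div_eq_iff hpos] at h1 h2
  rw [h3, h1, h2, hcdef]
  unfold moment
  field_simp
  ring

/-- The first and last B-splines are now test functions as well. All moments of `R` being zero, they
leave only the boundary terms `R a` and `R b`. -/
theorem exists_antideriv_orthogonal_zero (T : Mesh a b) (hab : a < b) (r : ℕ) {Q : ℝ → ℝ}
    (hQ : Continuous Q)
    (h : ∀ i < T.n + (r + 1), ∫ x in a..b, bspline (T.openKnots (r + 1)) (r + 1) i x * Q x = 0) :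
    ∃ R : ℝ → ℝ, (∀ x, HasDerivAt R (Q x) x) ∧ R a = 0 ∧ R b = 0 ∧
      ∀ i < T.n + r, ∫ x in a..b, bspline (T.openKnots r) r i x * R x = 0 := by
  have hn := T.n_pos hab
  obtain ⟨R, hR, h0⟩ := exists_antideriv_orthogonal T hab r hQ fun i hi => h _ (by omega)
  refine ⟨R, hR, ?_, ?_, h0⟩
  · have := integral_bspline_zero_mul T hab r hR hQ
    rw [h 0 (by omega), moment, h0 0 (by omega)] at this
    simpa using this
  · obtain ⟨i, hi⟩ : ∃ i, T.n + r = i + 1 := ⟨T.n + r - 1, by omega⟩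
    have := integral_bspline_succ_mul T hab r i hR hQ
    rw [h _ (by omega), if_pos hi.symm, ← hi, moment_last, moment, h0 i (by omega)] at this
    simpa using this.symm

/-- A function whose integrals over all elements vanish has an antiderivative that vanishes at all
breakpoints. -/
theorem exists_antideriv_node_zero (T : Mesh a b) (hab : a < b) {Q : ℝ → ℝ} (hQ : Continuous Q)
    (h : ∀ i < T.n, ∫ x in a..b, bspline (T.openKnots 0) 0 i x * Q x = 0) :
    ∃ W : ℝ → ℝ, (∀ x, HasDerivAt W (Q x) x) ∧ ∀ j ≤ T.n, W (T.node j) = 0 := by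
  refine ⟨fun x => ∫ y in a..x, Q y, fun x =>
    intervalIntegral.integral_hasDerivAt_right (hQ.intervalIntegrable _ _)
      (hQ.stronglyMeasurableAtFilter _ _) hQ.continuousAt, fun j hj => ?_⟩
  induction j with
  | zero => simp [T.node_zero]
  | succ j ih =>
    have h1 := h j (by omega)
    have hlt : T.node j ≤ T.node (j + 1) := T.node_mono (by omega)
    have e1 : ∀ x, bspline (T.openKnots 0) 0 j x * Q x =
        (Set.Ico (T.node j) (T.node (j + 1))).indicator Q x := fun x => by
      simp [bspline, T.openKnots_eq, Set.indicator, Set.mem_Ico]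
    simp only [e1] at h1
    have h2 : ∫ y in T.node j..T.node (j + 1), Q y = 0 := by
      rw [intervalIntegral.integral_of_le hlt, ← integral_Ico_eq_integral_Ioc]
      rw [intervalIntegral.integral_of_le hab.le, ← integral_Ico_eq_integral_Ioc,
        setIntegral_indicator measurableSet_Ico, Set.inter_eq_right.2] at h1
      · exact h1
      · exact Set.Ico_subset_Ico (T.le_node _) (T.node_le _)
    have ih' : ∫ y in a..T.node j, Q y = 0 := ih (by omega)
    beta_reduce
    rw [← intervalIntegral.integral_add_adjacent_intervals (hQ.intervalIntegrable a (T.node j))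
      (hQ.intervalIntegrable _ _), ih', h2, add_zero]

/-! ### Lower bound for alternations and the vanishing argument. -/

open Classical in
/-- The elements of a mesh on which a function is not identically zero. -/
noncomputable def activeElements (T : Mesh a b) (W : ℝ → ℝ) (j : ℕ) : Finset ℕ :=
  (Finset.range j).filter fun e => ∃ x ∈ Set.Ioo (T.node e) (T.node (e + 1)), W x ≠ 0

/-- If `W` vanishes at all breakpoints, its derivative has more alternations than `W` has
elements on which it does not vanish. -/
theorem AltSeq.of_activeElements {T : Mesh a b} {W R : ℝ → ℝ}
    (hd : ∀ x, HasDerivAt W (R x) x) (h0 : ∀ j ≤ T.n, W (T.node j) = 0) {j : ℕ} (hj : j ≤ T.n)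
    (hne : (activeElements T W j).Nonempty) :
    ∃ s ≠ 0, AltSeq a R ((activeElements T W j).card + 1) s (T.node j) := by
  have hc : Continuous W := continuous_iff_continuousAt.2 fun z => (hd z).continuousAt
  induction j with
  | zero => simp [activeElements] at hne
  | succ j ih =>
    unfold activeElements at hne ⊢
    rw [Finset.range_add_one, Finset.filter_insert] at hne ⊢
    by_cases hx : ∃ x ∈ Set.Ioo (T.node j) (T.node (j + 1)), W x ≠ 0
    · rw [if_pos hx, Finset.card_insert_of_notMem (by simp)]
      obtain ⟨x, hx, hWx⟩ := hx
      have hW1 := h0 j (by omega)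
      have hW2 := h0 (j + 1) hj
      -- On an active element `W` starts and ends at zero, so `R` takes the sign of `W x` before `x`
      -- and the opposite sign after it. The first active element contributes both signs, every
      -- later one whichever continues the alternation.
      have hleft : ∀ s, 0 < s * W x → ∃ y ∈ Set.Ico (T.node j) x, 0 < s * R y := fun s hs =>
        exists_right_deriv_pos hx.1 hc.continuousOn
          (fun z _ => (hd z).hasDerivWithinAt) (by rw [hW1]; linarith)
      have hright : ∀ s, 0 < -s * W x → ∃ y ∈ Set.Ico x (T.node (j + 1)), 0 < s * R y :=
        fun s hs => exists_right_deriv_pos hx.2 hc.continuousOn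
          (fun z _ => (hd z).hasDerivWithinAt) (by rw [hW2]; linarith)
      by_cases hE : (activeElements T W j).Nonempty
      · obtain ⟨s, hs, hA⟩ := ih (by omega) hE
        obtain ⟨y, hy, hy'⟩ : ∃ y ∈ Set.Ico (T.node j) (T.node (j + 1)), 0 < -s * R y := by
          rcases lt_or_gt_of_ne (mul_ne_zero hs hWx) with h | h
          · obtain ⟨y, hy, hy'⟩ := hleft (-s) (by linarith)
            exact ⟨y, ⟨hy.1, hy.2.trans hx.2⟩, hy'⟩
          · obtain ⟨y, hy, hy'⟩ := hright (-s) (by linarith)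
            exact ⟨y, ⟨hx.1.le.trans hy.1, hy.2⟩, hy'⟩
        refine ⟨-s, neg_ne_zero.2 hs, y, (T.le_node j).trans hy.1, hy.2, hy', ?_⟩
        rw [neg_neg]
        exact hA.mono hy.1
      · rw [Finset.not_nonempty_iff_eq_empty] at hE
        unfold activeElements at hE
        rw [hE, Finset.card_empty]
        have hpos : 0 < W x * W x := mul_self_pos.2 hWx
        obtain ⟨y, hy, hy'⟩ := hleft (W x) hpos
        obtain ⟨z, hz, hz'⟩ := hright (-W x) (by linarith)
        refine ⟨-W x, neg_ne_zero.2 hWx, z, (T.le_node j).trans (hx.1.le.trans hz.1), hz.2, hz',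
          y, (T.le_node j).trans hy.1, hy.2.trans_le hz.1, by rwa [neg_neg], trivial⟩
    · rw [if_neg hx] at hne ⊢
      obtain ⟨s, hs, hA⟩ := ih (by omega) hne
      exact ⟨s, hs, hA.mono (T.node_mono (by omega))⟩

theorem eq_zero_of_hasDerivAt_of_eq_zero {R Q : ℝ → ℝ} (hd : ∀ x, HasDerivAt R (Q x) x)
    {c d : ℝ} (h : ∀ x ∈ Set.Ioo c d, R x = 0) : ∀ x ∈ Set.Ioo c d, Q x = 0 := by
  intro x hx
  have hev : R =ᶠ[nhds x] fun _ => 0 := by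
    filter_upwards [Ioo_mem_nhds hx.1 hx.2] with y hy using h y hy
  exact (hd x).unique ((hasDerivAt_const x (0 : ℝ)).congr_of_eventuallyEq hev)

/-- A function orthogonal to the splines of degree `r` has at least `r` more alternations than
it has elements on which it does not vanish. -/
theorem exists_altSeq_of_orthogonal (T : Mesh a b) (hab : a < b) (r : ℕ) {Q : ℝ → ℝ}
    (hQ : Continuous Q)
    (h : ∀ i < T.n + r, ∫ x in a..b, bspline (T.openKnots r) r i x * Q x = 0) :
    ∃ E : Finset ℕ, (E.Nonempty → ∃ s, AltSeq a Q (E.card + r + 1) s b) ∧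
      ∀ e < T.n, e ∉ E → ∀ x ∈ Set.Ioo (T.node e) (T.node (e + 1)), Q x = 0 := by
  induction r generalizing Q with
  | zero =>
    obtain ⟨W, hW, h0⟩ := exists_antideriv_node_zero T hab hQ h
    -- `E` is fixed here, at degree 0, and kept in higher degrees: off it `W` and all its
    -- derivatives in the chain vanish.
    refine ⟨activeElements T W T.n, fun hne => ?_, fun e he hE => ?_⟩
    · obtain ⟨s, -, hs⟩ := AltSeq.of_activeElements hW h0 le_rfl hne
      rw [T.node_of_le le_rfl] at hs
      exact ⟨s, hs⟩
    · refine eq_zero_of_hasDerivAt_of_eq_zero hW fun x hx => ?_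
      by_contra hne
      exact hE (by simpa [activeElements] using ⟨he, x, hx, hne⟩)
  | succ r ih =>
    obtain ⟨R, hR, ha, hb, h0⟩ := exists_antideriv_orthogonal_zero T hab r hQ h
    have hRc : Continuous R := continuous_iff_continuousAt.2 fun z => (hR z).continuousAt
    obtain ⟨E, hE, hE'⟩ := ih hRc h0
    refine ⟨E, fun hne => ?_, fun e he heE =>
      eq_zero_of_hasDerivAt_of_eq_zero hR (hE' e he heE)⟩
    obtain ⟨s, hs⟩ := hE hne
    exact ⟨-s, hs.deriv_of_zero hR ha hb⟩

/-- A spline of degree `r + 1` on a mesh `T'` orthogonal to the interior B-splines of degree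
`r + 2` on a mesh `T` vanishes if each element of `T'` contains two elements of `T`. -/
theorem eq_zero_of_orthogonal (T T' : Mesh a b) (hab : a < b) (r : ℕ) {Q : ℝ → ℝ}
    (hQ : Continuous Q) (hp : IsPiecewise T' r Q)
    (h : ∀ i, i + 1 < T.n + r →
      ∫ x in a..b, bspline (T.openKnots (r + 1)) (r + 1) (i + 1) x * Q x = 0)
    {m : ℕ} (hm : 2 ≤ m) (hn : T.n = m * T'.n) (hx : ∀ j, T'.node j = T.node (m * j)) :
    ∀ e < T.n, ∀ x ∈ Set.Ioo (T.node e) (T.node (e + 1)), Q x = 0 := by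
  obtain ⟨R, hR, h0⟩ := exists_antideriv_orthogonal T hab r hQ h
  have hRc : Continuous R := continuous_iff_continuousAt.2 fun z => (hR z).continuousAt
  obtain ⟨E, hE, hE'⟩ := exists_altSeq_of_orthogonal T hab r hRc h0
  obtain ⟨E', hE'n, hA, hv⟩ := hp.exists_finset
  have hQ0 : ∀ e < T.n, e ∉ E → ∀ x ∈ Set.Ioo (T.node e) (T.node (e + 1)), Q x = 0 :=
    fun e he heE => eq_zero_of_hasDerivAt_of_eq_zero hR (hE' e he heE)
  rcases E.eq_empty_or_nonempty with hempty | hne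
  · intro e he; exact hQ0 e he (by simp [hempty])
  exfalso
  obtain ⟨s, hs⟩ := hE hne
  have h1 : E.card + r ≤ E'.card + r := hA _ _ (hs.right_deriv hRc.continuousOn
    fun z _ => (hR z).hasDerivWithinAt)
  have hpos := hne.card_pos
  -- The coarse element `e` consists of the fine elements `m * e, …, m * e + m - 1`. The first two
  -- lie in `E`, as `Q` vanishes identically on neither.
  have h2 : (E' ×ˢ Finset.range 2).card ≤ E.card := by
    refine Finset.card_le_card_of_injOn (fun q => m * q.1 + q.2) (fun q hq => ?_) ?_
    · rw [Finset.mem_coe, Finset.mem_product, Finset.mem_range] at hq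
      have h3 := Finset.mem_range.1 (hE'n hq.1)
      have h4 : m * (q.1 + 1) ≤ m * T'.n := Nat.mul_le_mul_left _ h3
      rw [mul_add, mul_one] at h4
      by_contra hnot
      have hlt : m * q.1 + q.2 < T.n := by omega
      obtain ⟨x, hx1, hx2⟩ := hv q.1 hq.1 _ _ (T.node_lt (Nat.lt_succ_self _) hlt) (by
        rw [hx, hx, mul_add, mul_one]
        exact Set.Ioo_subset_Ioo (T.node_mono (by omega)) (T.node_mono (by omega)))
      exact hx2 (hQ0 _ hlt hnot x hx1)
    · rintro ⟨u, v⟩ hq ⟨u', v'⟩ hq' heq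
      simp only [Finset.coe_product, Set.mem_prod, Finset.mem_coe, Finset.mem_range] at hq hq'
      dsimp only at heq
      have hu : u = u' := by
        have e1 : (m * u + v) / m = u := by
          rw [Nat.mul_add_div (by omega), Nat.div_eq_of_lt (by omega), add_zero]
        have e2 : (m * u' + v') / m = u' := by
          rw [Nat.mul_add_div (by omega), Nat.div_eq_of_lt (by omega), add_zero]
        rw [← e1, ← e2, heq]
      subst hu
      rw [Prod.mk.injEq]
      exact ⟨rfl, by omega⟩
  rw [Finset.card_product, Finset.card_range] at h2
  omega

/-! ### From trivial orthogonality to a positive inf-sup constant. -/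

/-- The orthogonal projection onto `V` is injective on `Q`, hence bounded below in finite dimension.
Testing `q` with its projection `v` makes the quotient `‖v‖ / ‖q‖`. -/
theorem infSupConst_pos {E : Type*} [NormedAddCommGroup E] [InnerProductSpace ℝ E]
    (V Q : Submodule ℝ E) [FiniteDimensional ℝ V] [FiniteDimensional ℝ Q] (hQ : Q ≠ ⊥)
    (h : ∀ q ∈ Q, (∀ v ∈ V, inner ℝ v q = 0) → q = 0) : 0 < infSupConst V Q := by
  let f : Q →ₗ[ℝ] V := V.orthogonalProjectionOnto.toLinearMap ∘ₗ Q.subtype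
  have hf : LinearMap.ker f = ⊥ := by
    rw [LinearMap.ker_eq_bot']
    intro q hq
    refine Subtype.ext (h q q.2 fun v hv => ?_)
    have hq' : V.orthogonalProjectionOnto (q : E) = 0 := hq
    rw [Submodule.orthogonalProjectionOnto_eq_zero_iff] at hq'
    exact (Submodule.mem_orthogonal V _).1 hq' v hv
  obtain ⟨K, hK, hanti⟩ := f.exists_antilipschitzWith hf
  have hK' : (0 : ℝ) < K := NNReal.coe_pos.2 hK
  -- A real infimum over an empty family is 0 by default, so a nonzero `q` is required.
  obtain ⟨q₀, hq₀, hq₀'⟩ := Submodule.exists_mem_ne_zero_of_ne_bot hQ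
  have : Nonempty {q : E // q ∈ Q ∧ q ≠ 0} := ⟨⟨q₀, hq₀, hq₀'⟩⟩
  refine (inv_pos.2 hK').trans_le (le_ciInf fun q => ?_)
  obtain ⟨q, hq, hq0⟩ := q
  have hqpos : 0 < ‖q‖ := norm_pos_iff.2 hq0
  have h1 : ‖q‖ ≤ K * ‖V.orthogonalProjectionOnto q‖ := by
    simpa [f] using ZeroHomClass.bound_of_antilipschitz f hanti ⟨q, hq⟩
  have hvpos : 0 < ‖V.orthogonalProjectionOnto q‖ := by
    by_contra hn
    have : ‖V.orthogonalProjectionOnto q‖ = 0 := le_antisymm (not_lt.1 hn) (norm_nonneg _)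
    rw [this, mul_zero] at h1
    linarith
  have hv0 : (V.orthogonalProjectionOnto q : E) ≠ 0 := by
    rw [← norm_pos_iff]; exact hvpos
  -- The supremum is genuine: Cauchy–Schwarz bounds the quotients by 1.
  refine le_trans ?_ (le_ciSup (f := fun v : {v : E // v ∈ V ∧ v ≠ 0} =>
    inner ℝ (v : E) q / (‖(v : E)‖ * ‖q‖)) ⟨1, ?_⟩
      ⟨V.orthogonalProjectionOnto q, (V.orthogonalProjectionOnto q).2, hv0⟩)
  · have h2 : inner ℝ (V.orthogonalProjectionOnto q : E) q = ‖V.orthogonalProjectionOnto q‖ ^ 2 := by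
      rw [← Submodule.inner_orthogonalProjectionOnto_eq_of_mem_left, real_inner_self_eq_norm_sq]
    have h3 : ‖(V.orthogonalProjectionOnto q : E)‖ = ‖V.orthogonalProjectionOnto q‖ := rfl
    simp only [h2, h3]
    rw [le_div_iff₀ (mul_pos hvpos hqpos), inv_mul_le_iff₀ hK']
    nlinarith
  · rintro _ ⟨v, rfl⟩
    exact div_le_one_of_le₀ (real_inner_le_norm _ _) (by positivity)

/-! ### Uniqueness of uniform meshes and breakpoints of the hierarchy. -/

theorem Mesh.ext_node {T T' : Mesh a b} (hn : T.n = T'.n) (h : ∀ j, T.node j = T'.node j) :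
    T = T' := by
  have hx : ∀ j (hj : j < T.n + 1) (hj' : j < T'.n + 1), T.x ⟨j, hj⟩ = T'.x ⟨j, hj'⟩ := by
    intro j hj hj'
    have := h j
    unfold Mesh.node at this
    simpa [min_eq_left (Nat.lt_succ_iff.1 hj), min_eq_left (Nat.lt_succ_iff.1 hj')] using this
  obtain ⟨n, x, _, _, _⟩ := T
  obtain ⟨n', x', _, _, _⟩ := T'
  obtain rfl : n = n' := hn
  obtain rfl : x = x' := funext fun i => hx i i.2 i.2
  rfl

theorem Mesh.IsUniform.node_eq {T : Mesh a b} {h : ℝ} (hT : T.IsUniform h) {j : ℕ}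
    (hj : j ≤ T.n) : T.node j = a + j * h := by
  induction j with
  | zero => simp [T.node_zero]
  | succ j ih =>
    have h1 : T.node (j + 1) - T.node j = h := by
      rw [← hT ⟨j, hj⟩]
      unfold Mesh.node
      congr 2 <;> ext <;> simp <;> omega
    have := ih (by omega)
    push_cast
    linarith

/-- From `b = a + n * h` with `h > 0`, the mesh size determines `n` and then every breakpoint. -/
theorem Mesh.IsUniform.unique {T T' : Mesh a b} {h : ℝ} (hh : 0 < h) (hT : T.IsUniform h)
    (hT' : T'.IsUniform h) : T = T' := by
  have h1 := hT.node_eq le_rfl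
  have h2 := hT'.node_eq le_rfl
  rw [Mesh.node_of_le _ le_rfl] at h1 h2
  have hn : T.n = T'.n := by
    have : (T.n : ℝ) = T'.n := mul_right_cancel₀ hh.ne' (by linarith)
    exact_mod_cast this
  refine Mesh.ext_node hn fun j => ?_
  rcases le_total j T.n with hj | hj
  · rw [hT.node_eq hj, hT'.node_eq (hn ▸ hj)]
  · rw [T.node_of_le hj, T'.node_of_le (hn ▸ hj)]

theorem Mesh.IsDyadicCoarsening.node_eq {T T' : Mesh a b} (h : T.IsDyadicCoarsening T') (j : ℕ) :
    T'.node j = T.node (2 * j) := by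
  obtain ⟨hn, hx⟩ := h
  unfold Mesh.node
  rw [hx]
  congr 1
  ext
  simp only
  omega

theorem IsDyadicHierarchy.node_eq {L : ℕ} {M : Fin (L + 1) → Mesh a b}
    (h : IsDyadicHierarchy M) (k : Fin (L + 1)) :
    (M 0).n = 2 ^ (k : ℕ) * (M k).n ∧ ∀ j, (M k).node j = (M 0).node (2 ^ (k : ℕ) * j) := by
  induction k using Fin.induction with
  | zero => simp
  | succ k ih =>
    obtain ⟨h1, h2⟩ := ih
    obtain ⟨hn, -⟩ := h k
    rw [Fin.val_castSucc] at h1 h2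
    rw [Fin.val_succ, pow_succ]
    refine ⟨by rw [h1, hn]; ring, fun j => ?_⟩
    rw [(h k).node_eq, h2]
    congr 1
    ring

/-! ### Transfer to the subspaces of `L²` and conclusion. -/

theorem integral_Ioo_toLp_mul (hab : a < b) {f : ℝ → ℝ}
    (hf : MemLp f 2 (volume.restrict (Set.Ioo a b))) (g : ℝ → ℝ) :
    ∫ x in Set.Ioo a b, (hf.toLp : L2 a b) x * g x = ∫ x in a..b, f x * g x := by
  rw [intervalIntegral.integral_of_le hab.le, integral_Ioc_eq_integral_Ioo]
  refine integral_congr_ae ?_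
  filter_upwards [hf.coeFn_toLp] with x hx
  rw [hx]

theorem memLp_bsplineDeriv (t : ℕ → ℝ) (a b : ℝ) (d i : ℕ) :
    MemLp (bsplineDeriv t d i) 2 (volume.restrict (Set.Ioo a b)) := by
  have := ((((memLp_bspline t a b d i).const_mul (1 / (t (i + d + 1) - t i))).sub
    ((memLp_bspline t a b d (i + 1)).const_mul (1 / (t (i + d + 2) - t (i + 1))))).const_mul
      ((d : ℝ) + 1))
  refine this.congr_norm ?_ (Filter.Eventually.of_forall fun x => ?_)
  · exact (((measurable_bspline t d i).div_const _).sub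
      ((measurable_bspline t d (i + 1)).div_const _)).const_mul _ |>.aestronglyMeasurable
  · congr 1
    simp only [bsplineDeriv, Pi.sub_apply]
    ring

/-- The interior B-splines of a mesh belong to its fine space. -/
theorem bspline_mem_fineSpace (T : Mesh a b) (hab : a < b) (r i : ℕ) (hi : i + 1 < T.n + r) :
    (memLp_bspline (T.openKnots (r + 1)) a b (r + 1) (i + 1)).toLp ∈ fineSpace (r + 1) T := by
  refine ⟨Submodule.subset_span ⟨⟨i + 1, by omega⟩, rfl⟩,
    ⟨(memLp_bsplineDeriv (T.openKnots (r + 1)) a b r (i + 1)).toLp, fun φ hφ => ?_⟩, ?_⟩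
  · rw [integral_Ioo_toLp_mul hab, integral_Ioo_toLp_mul hab,
      integral_bspline_mul_deriv T hab r (i + 1) (R := φ)
        (fun x => ((hφ.1.differentiable (by simp)) x).hasDerivAt) hφ.continuous_deriv,
      if_neg (by omega), if_neg (by omega)]
    ring
  · obtain ⟨w, hw, hwe, hwb⟩ := exists_continuous_bspline T hab (r + 1) r (i + 1)
    refine ⟨w, hw.continuousOn, ?_, ?_, ?_⟩
    · filter_upwards [(memLp_bspline (T.openKnots (r + 1)) a b (r + 1) (i + 1)).coeFn_toLp,
        ae_restrict_mem measurableSet_Ioo] with x h1 h2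
      rw [h1, hwe (Set.Ioo_subset_Ico_self h2)]
    · rw [hwe ⟨le_rfl, hab⟩, bspline_left T hab, if_neg (by omega)]
    · rw [hwb, if_neg (by omega)]

/-- The degree is positive, so the generators have continuous versions; for the coarse space this is
where `p ≥ 2` enters. -/
theorem exists_representative (T : Mesh a b) (hab : a < b) (d : ℕ) {q : L2 a b}
    (hq : q ∈ splineSpace (d + 1) T) : ∃ Q : ℝ → ℝ, Continuous Q ∧ IsPiecewise T (d + 1) Q ∧
      (q : ℝ → ℝ) =ᵐ[volume.restrict (Set.Ioo a b)] Q := by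
  induction hq using Submodule.span_induction with
  | mem q hq =>
    obtain ⟨i, rfl⟩ := hq
    obtain ⟨w, hw, hwe, -⟩ := exists_continuous_bspline T hab (d + 1) d i
    refine ⟨w, hw, (isPiecewise_bspline T hab (d + 1) (d + 1) i).congr hwe, ?_⟩
    filter_upwards [(memLp_bspline (T.openKnots (d + 1)) a b (d + 1) i).coeFn_toLp,
      ae_restrict_mem measurableSet_Ioo] with x h1 h2
    rw [h1, hwe (Set.Ioo_subset_Ico_self h2)]
  | zero => exact ⟨fun _ => 0, continuous_const, IsPiecewise.zero T _, Lp.coeFn_zero _ _ _⟩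
  | add u v _ _ hu hv =>
    obtain ⟨U, hU, hU', hU''⟩ := hu
    obtain ⟨V, hV, hV', hV''⟩ := hv
    refine ⟨fun x => U x + V x, hU.add hV, hU'.add hV', ?_⟩
    filter_upwards [Lp.coeFn_add u v, hU'', hV''] with x h1 h2 h3
    rw [h1, Pi.add_apply, h2, h3]
  | smul c u _ hu =>
    obtain ⟨U, hU, hU', hU''⟩ := hu
    refine ⟨fun x => c * U x, hU.const_mul c, hU'.const_mul c, ?_⟩
    filter_upwards [Lp.coeFn_smul c u, hU''] with x h1 h2
    rw [h1, Pi.smul_apply, h2, smul_eq_mul]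

theorem Mesh.exists_mem_Ico (T : Mesh a b) {x : ℝ} (hx : x ∈ Set.Ico a b) :
    ∃ e < T.n, x ∈ Set.Ico (T.node e) (T.node (e + 1)) := by
  have : ∀ j, x < T.node j → ∃ e < j, x ∈ Set.Ico (T.node e) (T.node (e + 1)) := by
    intro j hj
    induction j with
    | zero => rw [T.node_zero] at hj; exact absurd hx.1 (not_le.2 hj)
    | succ j ih =>
      by_cases h : x < T.node j
      · obtain ⟨e, he, he'⟩ := ih h
        exact ⟨e, by omega, he'⟩
      · exact ⟨j, by omega, not_lt.1 h, hj⟩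
  exact this T.n (by rw [T.node_of_le le_rfl]; exact hx.2)

theorem eq_zero_of_inner_fineSpace (T T' : Mesh a b) (hab : a < b) (d : ℕ) {m : ℕ} (hm : 2 ≤ m)
    (hn : T.n = m * T'.n) (hx : ∀ j, T'.node j = T.node (m * j)) {q : L2 a b}
    (hq : q ∈ splineSpace (d + 1) T') (h : ∀ v ∈ fineSpace (d + 2) T, inner ℝ v q = 0) :
    q = 0 := by
  obtain ⟨Q, hQ, hp, hqQ⟩ := exists_representative T' hab d hq
  have hzero := eq_zero_of_orthogonal T T' hab (d + 1) hQ hp (fun i hi => by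
    have h1 := h _ (bspline_mem_fineSpace T hab (d + 1) i hi)
    rw [L2.inner_def] at h1
    rw [← integral_Ioo_toLp_mul hab (memLp_bspline _ a b _ _), ← h1]
    refine integral_congr_ae ?_
    filter_upwards [hqQ] with x hx
    rw [hx]
    simp [mul_comm]) hm hn hx
  rw [Lp.eq_zero_iff_ae_eq_zero]
  filter_upwards [hqQ, ae_restrict_mem measurableSet_Ioo] with x h1 h2
  rw [h1]
  obtain ⟨e, he, hxe⟩ := T.exists_mem_Ico (Set.Ioo_subset_Ico_self h2)
  have hlt := T.node_lt (Nat.lt_succ_self e) he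
  -- Vanishing on open elements extends to the breakpoints by continuity.
  have hcl : x ∈ closure (Set.Ioo (T.node e) (T.node (e + 1))) := by
    rw [closure_Ioo hlt.ne]; exact Set.Ico_subset_Icc_self hxe
  have : Set.EqOn Q (fun _ => 0) (closure (Set.Ioo (T.node e) (T.node (e + 1)))) :=
    Set.EqOn.closure (fun y hy => hzero e he y hy) hQ continuous_const
  exact this hcl

/-- The first B-spline has the nonzero moment `1 / (r + 1)` against 1. -/
theorem splineSpace_ne_bot (T : Mesh a b) (hab : a < b) (r : ℕ) : splineSpace r T ≠ ⊥ := by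
  have hn := T.n_pos hab
  intro hbot
  have hmem : (memLp_bspline (T.openKnots r) a b r 0).toLp ∈ splineSpace r T :=
    Submodule.subset_span ⟨⟨0, by omega⟩, rfl⟩
  rw [hbot, Submodule.mem_bot] at hmem
  have h1 := moment_const_one T hab r 0 (by omega)
  have h2 : ∫ x in a..b, bspline (T.openKnots r) r 0 x * 1 = 0 := by
    rw [← integral_Ioo_toLp_mul hab (memLp_bspline _ a b _ _), hmem]
    refine integral_eq_zero_of_ae ?_
    filter_upwards [Lp.coeFn_zero ℝ 2 (volume.restrict (Set.Ioo a b))] with x hx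
    rw [hx]; simp
  rw [moment, h2, zero_div] at h1
  have : (0 : ℝ) < 1 / (r + 1) := by positivity
  linarith

instance finiteDimensional_splineSpace (T : Mesh a b) (r : ℕ) :
    FiniteDimensional ℝ (splineSpace r T) :=
  FiniteDimensional.span_of_finite ℝ (Set.finite_range _)

instance finiteDimensional_fineSpace (T : Mesh a b) (p : ℕ) :
    FiniteDimensional ℝ (fineSpace p T) :=
  Submodule.finiteDimensional_of_le (inf_le_left : fineSpace p T ≤ splineSpace p T)

theorem infSupConst_fineSpace_coarseSpace_pos (hab : a < b) {p : ℕ} (hp : 2 ≤ p) {L : ℕ}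
    (hL : 1 ≤ L) {M : Fin (L + 1) → Mesh a b} (hM : IsDyadicHierarchy M) :
    0 < infSupConst (fineSpace p (M 0)) (coarseSpace p (M (Fin.last L))) := by
  obtain ⟨d, rfl⟩ : ∃ d, p = d + 2 := ⟨p - 2, by omega⟩
  obtain ⟨hn, hx⟩ := hM.node_eq (Fin.last L)
  have hm : 2 ≤ 2 ^ ((Fin.last L : Fin (L + 1)) : ℕ) := by
    rw [Fin.val_last]
    exact Nat.le_self_pow (by omega) 2
  exact infSupConst_pos _ (splineSpace (d + 1) (M (Fin.last L))) (splineSpace_ne_bot _ hab _)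
    fun q hq h => eq_zero_of_inner_fineSpace _ _ hab d hm hn hx hq h

end SplineInfSup

theorem mainTheorem3 (a b : ℝ) (hab : a < b) (p : ℕ) (hp : 2 ≤ p) (L : ℕ) (hL : 1 ≤ L)
    (h : ℝ) (hh : 0 < h) :
    ∃ α : ℝ, 0 < α ∧
      ∀ M : Fin (L + 1) → SplineInfSup.Mesh a b,
        (M 0).IsUniform h → SplineInfSup.IsDyadicHierarchy M →
          α ≤ SplineInfSup.infSupConst
            (SplineInfSup.fineSpace p (M 0)) (SplineInfSup.coarseSpace p (M (Fin.last L))) := by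
  -- The constant must be chosen before `M`. For given `h` the finest and coarsest meshes are
  -- unique, so the inf-sup constant of any one hierarchy serves for all; if none exists, any
  -- positive number does.
  by_cases hex : ∃ M : Fin (L + 1) → SplineInfSup.Mesh a b,
      (M 0).IsUniform h ∧ SplineInfSup.IsDyadicHierarchy M
  · obtain ⟨M, hu, hd⟩ := hex
    refine ⟨_, SplineInfSup.infSupConst_fineSpace_coarseSpace_pos hab hp hL hd,
      fun M' hu' hd' => ?_⟩
    have h0 : M' 0 = M 0 := hu'.unique hh hu
    obtain ⟨hn, hx⟩ := hd.node_eq (Fin.last L)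
    obtain ⟨hn', hx'⟩ := hd'.node_eq (Fin.last L)
    have hl : M' (Fin.last L) = M (Fin.last L) := by
      refine SplineInfSup.Mesh.ext_node ?_ fun j => by rw [hx, hx', h0]
      rw [h0, hn] at hn'
      exact (Nat.eq_of_mul_eq_mul_left (by positivity) hn').symm
    rw [h0, hl]
  · exact ⟨1, one_pos, fun M hu hd => absurd ⟨M, hu, hd⟩ hex⟩
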